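/- **Proposition 3 (Sufficient condition for equivalence of value conditions).** Let $f(\rho)=\rho\,v(\rho)$, $\rho\in[0,\rho_{max}]$, $\rho_{max}>0$, be a fundamental diagram: $v$ is decreasing with values in $[0,v_{max}]$, and $f$ is concave and attains its maximum on $[0,\rho_{max}]$. Put $\psi(s)=f(1/s)\,s$ and let $\delta>0$. Consider the Hamilton–Jacobi equations $$N_t-f(-N_x)=0\quad\text{(Eulerian)},\qquad X_t-\psi(-X_n)=0\quad\text{(Lagrangian)}$$ on domains $\Omega^E$ of points $(t,x)$ and $\Omega^L$ of points $(t,n)$ whose time slices are intervals that vary lower semicontinuously with $t$ (for instance products of two intervals, or open sets whose time slices are intervals). Let $\mathcal C^E$ and $\mathcal C^L$ be continuous value conditions, whose domains are continuous curves $(t(\tau),x(\tau))\in\Omega^E$ and $(t(\tau),n(\tau))\in\Omega^L$, $\tau\in[\tau_{min},\tau_{max}]$, and which are continuous functions of $\tau$ along them. An *Eulerian solution* is a function $N$, continuous on $\Omega^E$, that is a viscosity solution of the Eulerian equation in the interior of $\Omega^E$, whose density $-N_x$ lies in $[\delta,\rho_{max}]$ (that is, $\delta(x_2-x_1)\le N(t,x_1)-N(t,x_2)\le\rho_{max}(x_2-x_1)$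 for $(t,x_1),(t,x_2)\in\Omega^E$, $x_1\le x_2$), and that satisfies the value condition in the equality sense, $N(t(\tau),x(\tau))=\mathcal C^E(t(\tau),x(\tau))$ for all $\tau$. A *Lagrangian solution* is a function $X$, continuous on $\Omega^L$, that is a viscosity solution of the Lagrangian equation in the interior of $\Omega^L$, whose spacing $-X_n$ lies in $[1/\rho_{max},1/\delta]$ in the same sense, and that satisfies $X(t(\tau),n(\tau))=\mathcal C^L(t(\tau),n(\tau))$ for all $\tau$. The *image* of $N$ is $\{(t,N(t,x)):(t,x)\in\Omega^E\}$, that of $X$ is $\{(t,X(t,n)):(t,n)\in\Omega^L\}$. $N$ and $X$ are *partial inverses* of each other if for each $t$ the functions $N(t,\cdot)$ and $X(t,\cdot)$ are mutually inverse bijections between the time slices of $\Omega^E$ and $\Omega^L$. Suppose that for all $\tau\in[\tau_{min},\tau_{max}]$ $$n(\tau)=\mathcal C^E\big(t(\tau),x(\tau)\big),\qquad x(\tau)=\mathcal C^L\big(t(\tau),n(\tau)\big).$$ Then the solutions of the two problems are equivalent: 1. Every Eulerian solution $N$ with image $\Omega^L$ has a partial inverse, and this is a Lagrangian solution (it satisfies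 $\mathcal C^L$). Every Lagrangian solution $X$ with image $\Omega^E$ has a partial inverse, and this is an Eulerian solution (it satisfies $\mathcal C^E$). 2. Hence the Eulerian solution, inverted in $x$, is the Lagrangian solution, whenever the latter is uniquely determined: if $N$ is an Eulerian solution with image $\Omega^L$, and $X$ is a Lagrangian solution with which every Lagrangian solution with image $\Omega^E$ agrees on $\Omega^L$, then $N$ and $X$ are partial inverses of each other. The same holds with the two roles exchanged. 3. There is exactly one Eulerian solution with image $\Omega^L$ if and only if there is exactly one Lagrangian solution with image $\Omega^E$ (as functions on $\Omega^E$ and $\Omega^L$). -/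

import Mathlib

open Set Filter Topology

namespace LWR

/-- `f` is a fundamental diagram with speed function `v`: the flow is `f ρ = ρ v(ρ)` for densities
`ρ ∈ [0, ρmax]`, the speed `v` is decreasing with values in `[0, vmax]`, and `f` is concave and
attains its maximum (the flow capacity) at some `ρ* ∈ [0, ρmax]`. -/
structure IsFundamentalDiagram (f v : ℝ → ℝ) (ρmax vmax : ℝ) : Prop where
  ρmax_pos : 0 < ρmax
  flow_eq : ∀ ρ ∈ Icc 0 ρmax, f ρ = ρ * v ρ
  speed_mem : ∀ ρ ∈ Icc 0 ρmax, v ρ ∈ Icc 0 vmax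
  speed_anti : AntitoneOn v (Icc 0 ρmax)
  concave : ConcaveOn ℝ (Icc 0 ρmax) f
  exists_max : ∃ ρstar ∈ Icc 0 ρmax, IsMaxOn f (Icc 0 ρmax) ρstar

/-- The spacing-velocity relation `ψ(s) = f(1/s) s`. -/
noncomputable def spacingVelocity (f : ℝ → ℝ) (s : ℝ) : ℝ := f (1 / s) * s

/-- The space-time domains considered (points are `(t, y)`, with `y` a position or a vehicle label):
every time slice is an interval, and the slices vary lower semicontinuously with time.
All products `I ×ˢ J` of two intervals are of this kind, and so are all open sets whose time slices
are intervals. -/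
structure IsDomain (Ω : Set (ℝ × ℝ)) : Prop where
  slice : ∀ t : ℝ, {y : ℝ | (t, y) ∈ Ω}.OrdConnected
  lsc : ∀ p ∈ Ω, ∀ ε > (0 : ℝ), ∀ᶠ t in 𝓝[Prod.fst '' Ω] p.1, ∃ y : ℝ, (t, y) ∈ Ω ∧ |y - p.2| < ε

/-- `u` is a viscosity subsolution of `u_t + H(u_y) = 0` on `Ω`: it is continuous on `Ω` and
`φ_t + H(φ_y) ≤ 0` at every interior point of `Ω` at which `u - φ` has a local maximum, for every
`φ` that is continuously differentiable near that point. -/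
def IsViscositySubsolution (H : ℝ → ℝ) (Ω : Set (ℝ × ℝ)) (u : ℝ × ℝ → ℝ) : Prop :=
  ContinuousOn u Ω ∧
    ∀ (φ : ℝ × ℝ → ℝ), ∀ p ∈ interior Ω, ContDiffAt ℝ 1 φ p → IsLocalMax (fun q => u q - φ q) p →
      fderiv ℝ φ p (1, 0) + H (fderiv ℝ φ p (0, 1)) ≤ 0

/-- `u` is a viscosity supersolution of `u_t + H(u_y) = 0` on `Ω`. -/
def IsViscositySupersolution (H : ℝ → ℝ) (Ω : Set (ℝ × ℝ)) (u : ℝ × ℝ → ℝ) : Prop :=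
  ContinuousOn u Ω ∧
    ∀ (φ : ℝ × ℝ → ℝ), ∀ p ∈ interior Ω, ContDiffAt ℝ 1 φ p → IsLocalMin (fun q => u q - φ q) p →
      0 ≤ fderiv ℝ φ p (1, 0) + H (fderiv ℝ φ p (0, 1))

/-- `u` is a viscosity solution of `u_t + H(u_y) = 0` on `Ω`. -/
def IsViscositySolution (H : ℝ → ℝ) (Ω : Set (ℝ × ℝ)) (u : ℝ × ℝ → ℝ) : Prop :=
  IsViscositySubsolution H Ω u ∧ IsViscositySupersolution H Ω u

/-- `a ≤ -u_y ≤ b` on `Ω`, in integrated form: on every time slice `u` is decreasing in `y`, at a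
rate between `a` and `b`. For a Moskowitz function `-u_y` is the density, for the position function
of the vehicles it is the spacing. -/
def DecreasesAtRate (a b : ℝ) (Ω : Set (ℝ × ℝ)) (u : ℝ × ℝ → ℝ) : Prop :=
  ∀ t y₁ y₂ : ℝ, (t, y₁) ∈ Ω → (t, y₂) ∈ Ω → y₁ ≤ y₂ →
    a * (y₂ - y₁) ≤ u (t, y₁) - u (t, y₂) ∧ u (t, y₁) - u (t, y₂) ≤ b * (y₂ - y₁)

/-- `C` is a continuous value condition on `Ω`: its domain is the continuous curve
`τ ↦ (t τ, y τ)`, `τ ∈ [τmin, τmax]`, contained in `Ω`, and `τ ↦ C (t τ, y τ)` is continuous.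
The values of `C` off the curve are never used. -/
structure IsValueCondition (Ω : Set (ℝ × ℝ)) (τmin τmax : ℝ) (t y : ℝ → ℝ)
    (C : ℝ × ℝ → ℝ) : Prop where
  le : τmin ≤ τmax
  continuousOn_time : ContinuousOn t (Icc τmin τmax)
  continuousOn_space : ContinuousOn y (Icc τmin τmax)
  mem : ∀ τ ∈ Icc τmin τmax, (t τ, y τ) ∈ Ω
  continuousOn_value : ContinuousOn (fun τ => C (t τ, y τ)) (Icc τmin τmax)

/-- `u` satisfies the value condition `C` in the equality sense. -/
def SatisfiesValue (τmin τmax : ℝ) (t y : ℝ → ℝ) (C u : ℝ × ℝ → ℝ) : Prop :=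
  ∀ τ ∈ Icc τmin τmax, u (t τ, y τ) = C (t τ, y τ)

/-- `N` solves the Eulerian problem on `Ω`: it is a viscosity solution of `N_t - f(-N_x) = 0`,
its density `-N_x` lies in `[δ, ρmax]`, and `N = C` along the curve `(t, x)`. -/
structure IsEulerianSolution (f : ℝ → ℝ) (δ ρmax : ℝ) (Ω : Set (ℝ × ℝ)) (τmin τmax : ℝ)
    (t x : ℝ → ℝ) (C N : ℝ × ℝ → ℝ) : Prop where
  viscosity : IsViscositySolution (fun p => -f (-p)) Ω N
  density : DecreasesAtRate δ ρmax Ω N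
  value : SatisfiesValue τmin τmax t x C N

/-- `X` solves the Lagrangian problem on `Ω`: it is a viscosity solution of `X_t - ψ(-X_n) = 0`,
its spacing `-X_n` lies in `[1/ρmax, 1/δ]`, and `X = C` along the curve `(t, n)`. -/
structure IsLagrangianSolution (f : ℝ → ℝ) (δ ρmax : ℝ) (Ω : Set (ℝ × ℝ)) (τmin τmax : ℝ)
    (t n : ℝ → ℝ) (C X : ℝ × ℝ → ℝ) : Prop where
  viscosity : IsViscositySolution (fun p => -spacingVelocity f (-p)) Ω X
  spacing : DecreasesAtRate (1 / ρmax) (1 / δ) Ω X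
  value : SatisfiesValue τmin τmax t n C X

/-- The image `{(t, u(t, y)) | (t, y) ∈ Ω}`, that is, the domain of the partial inverse of `u`. -/
def dualDomain (Ω : Set (ℝ × ℝ)) (u : ℝ × ℝ → ℝ) : Set (ℝ × ℝ) :=
  (fun p : ℝ × ℝ => (p.1, u p)) '' Ω

/-- `N` on `ΩE` and `X` on `ΩL` are partial inverses of each other: for each fixed time `t`,
`X(t, ·)` is the inverse of `N(t, ·)`, as maps between the time slices of `ΩE` and `ΩL`. -/
def ArePartialInverses (ΩE ΩL : Set (ℝ × ℝ)) (N X : ℝ × ℝ → ℝ) : Prop :=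
  (∀ t x : ℝ, (t, x) ∈ ΩE → (t, N (t, x)) ∈ ΩL ∧ X (t, N (t, x)) = x) ∧
    (∀ t n : ℝ, (t, n) ∈ ΩL → (t, X (t, n)) ∈ ΩE ∧ N (t, X (t, n)) = n)

end LWR

/-! Inverting in the second variable turns one equation into the other. If `φ(t, Φ(t, z)) = z`, then
`φ_t + φ_y Φ_t = 0` and `φ_y Φ_z = 1`, so with `G s = F(1/s) s` the residual of one equation is the
residual of the other times `-φ_y`. The rate bounds make `-φ_y` positive wherever a test function
touches a solution, so the viscosity inequalities keep their sign. To make this rigorous,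
`ArePartialInverses.exists_testFunction` inverts test functions by the inverse function theorem. The
domain hypotheses enter in `ArePartialInverses.continuousOn` (lower semicontinuous slices) and
`ArePartialInverses.mem_interior` (interval slices). The value conditions correspond because both
describe the same curve `(t, x, n)`. Uniqueness transfers because a partial inverse is determined on
its domain. -/

namespace LWR

/-! ### Partial inverses: existence, rates, continuity, interior points -/

section Inverses

variable {Ω Ω' : Set (ℝ × ℝ)} {u w w' : ℝ × ℝ → ℝ} {a b : ℝ}

theorem ArePartialInverses.symm (h : ArePartialInverses Ω Ω' u w) :
    ArePartialInverses Ω' Ω w u :=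
  ⟨h.2, h.1⟩

theorem ArePartialInverses.congr_right (h : ArePartialInverses Ω Ω' u w) (hw : EqOn w w' Ω') :
    ArePartialInverses Ω Ω' u w' := by
  refine ⟨fun t y hy => ?_, fun t z hz => ?_⟩
  · obtain ⟨h1, h2⟩ := h.1 t y hy
    exact ⟨h1, (hw h1).symm.trans h2⟩
  · rw [← hw hz]
    exact h.2 t z hz

theorem ArePartialInverses.eqOn (h : ArePartialInverses Ω Ω' u w)
    (h' : ArePartialInverses Ω Ω' u w') : EqOn w w' Ω' := by
  rintro ⟨t, z⟩ hz
  obtain ⟨h1, h2⟩ := h.2 t z hz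
  have h3 := (h'.1 _ _ h1).2
  rw [h2] at h3
  exact h3.symm

theorem ArePartialInverses.dualDomain_eq (h : ArePartialInverses Ω Ω' u w) :
    dualDomain Ω u = Ω' := by
  ext ⟨t, z⟩
  constructor
  · rintro ⟨⟨s, y⟩, hy, hsy⟩
    simp only [Prod.mk.injEq] at hsy
    obtain ⟨rfl, rfl⟩ := hsy
    exact (h.1 _ _ hy).1
  · intro hz
    obtain ⟨h1, h2⟩ := h.2 t z hz
    exact ⟨(t, w (t, z)), h1, by simp [h2]⟩

theorem DecreasesAtRate.eq_of_eq (hu : DecreasesAtRate a b Ω u) (ha : 0 < a) {t y₁ y₂ : ℝ}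
    (h₁ : (t, y₁) ∈ Ω) (h₂ : (t, y₂) ∈ Ω) (h : u (t, y₁) = u (t, y₂)) : y₁ = y₂ := by
  rcases le_total y₁ y₂ with hle | hle
  · have := (hu t y₁ y₂ h₁ h₂ hle).1
    nlinarith
  · have := (hu t y₂ y₁ h₂ h₁ hle).1
    nlinarith

theorem DecreasesAtRate.exists_arePartialInverses (hu : DecreasesAtRate a b Ω u) (ha : 0 < a)
    (hΩ : dualDomain Ω u = Ω') : ∃ w, ArePartialInverses Ω Ω' u w := by
  have hex : ∀ q : ℝ × ℝ, ∃ y : ℝ, q ∈ Ω' → (q.1, y) ∈ Ω ∧ u (q.1, y) = q.2 := by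
    intro q
    by_cases hq : q ∈ Ω'
    · rw [← hΩ] at hq
      obtain ⟨p, hp, rfl⟩ := hq
      exact ⟨p.2, fun _ => ⟨hp, rfl⟩⟩
    -- Junk value off `Ω'`, where nothing is required of `w`.
    · exact ⟨0, fun h => absurd h hq⟩
  choose w hw using hex
  refine ⟨w, fun t y hy => ?_, fun t z hz => hw _ hz⟩
  have hmem : (t, u (t, y)) ∈ Ω' := hΩ ▸ ⟨(t, y), hy, rfl⟩
  obtain ⟨h1, h2⟩ := hw _ hmem
  exact ⟨hmem, hu.eq_of_eq ha h1 hy h2⟩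

theorem DecreasesAtRate.inverse (hu : DecreasesAtRate a b Ω u) (ha : 0 < a) (hb : 0 < b)
    (h : ArePartialInverses Ω Ω' u w) : DecreasesAtRate (1 / b) (1 / a) Ω' w := by
  intro t z₁ z₂ h₁ h₂ hz
  obtain ⟨m₁, e₁⟩ := h.2 t z₁ h₁
  obtain ⟨m₂, e₂⟩ := h.2 t z₂ h₂
  have hle : w (t, z₂) ≤ w (t, z₁) := by
    by_contra hlt
    push Not at hlt
    have := (hu t _ _ m₁ m₂ hlt.le).1
    rw [e₁, e₂] at this
    nlinarith
  obtain ⟨r₁, r₂⟩ := hu t _ _ m₂ m₁ hle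
  rw [e₁, e₂] at r₁ r₂
  constructor
  · rw [one_div, inv_mul_le_iff₀ hb]
    exact r₂
  · rw [one_div, ← div_eq_inv_mul, le_div_iff₀ ha]
    linarith

theorem DecreasesAtRate.abs_sub_le (hu : DecreasesAtRate a b Ω u) {t y₁ y₂ : ℝ}
    (h₁ : (t, y₁) ∈ Ω) (h₂ : (t, y₂) ∈ Ω) (ha : 0 ≤ a) :
    |u (t, y₁) - u (t, y₂)| ≤ b * |y₁ - y₂| := by
  rcases le_total y₁ y₂ with hle | hle
  · obtain ⟨l, r⟩ := hu t y₁ y₂ h₁ h₂ hle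
    have : 0 ≤ a * (y₂ - y₁) := mul_nonneg ha (sub_nonneg.2 hle)
    rw [abs_of_nonneg (by linarith), abs_sub_comm, abs_of_nonneg (by linarith)]
    exact r
  · obtain ⟨l, r⟩ := hu t y₂ y₁ h₂ h₁ hle
    have : 0 ≤ a * (y₁ - y₂) := mul_nonneg ha (sub_nonneg.2 hle)
    rw [abs_sub_comm, abs_of_nonneg (by linarith), abs_of_nonneg (by linarith)]
    exact r

/-- Each `w(t, ·)` is `1/a`-Lipschitz, uniformly in `t`. To compare different times, lower
semicontinuity supplies `y` in the slice at `t` close to `w(t₀, z₀)`; then `u(t, y)` is close to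
`z₀`, hence to `z`, and `w(t, z)` is close to `w(t, u(t, y)) = y`. -/
theorem ArePartialInverses.continuousOn (h : ArePartialInverses Ω Ω' u w) (hΩ : IsDomain Ω)
    (hu : DecreasesAtRate a b Ω u) (hc : ContinuousOn u Ω) (ha : 0 < a) (hb : 0 < b) :
    ContinuousOn w Ω' := by
  have hw := hu.inverse ha hb h
  rintro ⟨t₀, z₀⟩ hz₀
  obtain ⟨m₀, e₀⟩ := h.2 t₀ z₀ hz₀
  rw [Metric.continuousWithinAt_iff]
  intro ε hε
  obtain ⟨η, hη, hcη⟩ := Metric.continuousWithinAt_iff.1 (hc _ m₀) (a * ε / 4) (by positivity)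
  have hlsc := hΩ.lsc _ m₀ (min η (ε / 2)) (by positivity)
  rw [eventually_nhdsWithin_iff, Metric.eventually_nhds_iff] at hlsc
  obtain ⟨ζ, hζ, hlsc⟩ := hlsc
  refine ⟨min ζ (min η (a * ε / 4)), by positivity, ?_⟩
  rintro ⟨t, z⟩ hz hd
  rw [Prod.dist_eq, max_lt_iff] at hd
  simp only [lt_min_iff] at hd
  obtain ⟨⟨d1, d2, -⟩, -, -, d3⟩ := hd
  obtain ⟨m, e⟩ := h.2 t z hz
  obtain ⟨y, hy, hyd⟩ := hlsc d1 ⟨_, m, rfl⟩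
  rw [lt_min_iff] at hyd
  have hclose := hcη hy (by
    rw [Prod.dist_eq, max_lt_iff]
    exact ⟨d2, by simpa [Real.dist_eq] using hyd.1⟩)
  rw [e₀] at hclose
  obtain ⟨m', e'⟩ := h.1 t y hy
  have hle := hw.abs_sub_le hz m' (by positivity)
  rw [e'] at hle
  rw [Real.dist_eq] at hclose d3 ⊢
  have hzu : |z - u (t, y)| < a * ε / 2 := by
    rw [abs_lt] at *
    constructor <;> linarith [hclose.1, hclose.2, d3.1, d3.2]
  have hlt : 1 / a * |z - u (t, y)| < ε / 2 := by
    rw [one_div, inv_mul_lt_iff₀ ha]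
    linarith
  calc |w (t, z) - w (t₀, z₀)| ≤ |w (t, z) - y| + |y - w (t₀, z₀)| := abs_sub_le _ _ _
    _ < ε := by linarith [hyd.2]

/-- The curves `w(t, z₀ ± r/2)` lie in `Ω`, are continuous at `t₀`, and strictly enclose `w(t₀, z₀)`
at `t₀`. Nearby points stay between them, and the slices of `Ω` are intervals. -/
theorem ArePartialInverses.mem_interior (h : ArePartialInverses Ω Ω' u w) (hΩ : IsDomain Ω)
    (hw : DecreasesAtRate a b Ω' w) (hc : ContinuousOn w Ω') (ha : 0 < a) {q : ℝ × ℝ}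
    (hq : q ∈ interior Ω') : (q.1, w q) ∈ interior Ω := by
  obtain ⟨t₀, z₀⟩ := q
  rw [mem_interior_iff_mem_nhds, nhds_prod_eq, mem_prod_iff] at hq
  obtain ⟨U, hU, V, hV, hUV⟩ := hq
  obtain ⟨r, hr, hrV⟩ := Metric.mem_nhds_iff.1 hV
  have hVmem : ∀ z, |z - z₀| < r → z ∈ V := fun z hz => hrV (by simpa [Real.dist_eq] using hz)
  have hcont : ∀ z, |z - z₀| < r → Tendsto (fun t => w (t, z)) (𝓝 t₀) (𝓝 (w (t₀, z))) := by
    intro z hz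
    have hV' : V ∈ 𝓝 z := by
      refine mem_of_superset (Metric.ball_mem_nhds z (sub_pos.2 hz)) fun z' hz' => hVmem _ ?_
      rw [Metric.mem_ball, Real.dist_eq] at hz'
      linarith [abs_sub_le z' z z₀]
    have hat : ContinuousAt w (t₀, z) :=
      hc.continuousAt (mem_of_superset (prod_mem_nhds hU hV') hUV)
    exact hat.tendsto.comp (Continuous.tendsto (f := fun t : ℝ => (t, z)) (by fun_prop) t₀)
  have hmem₀ := mem_of_mem_nhds hU
  have m0 : (t₀, z₀) ∈ Ω' := hUV ⟨hmem₀, hVmem _ (by simpa using hr)⟩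
  have hp : |z₀ + r / 2 - z₀| < r := by rw [add_sub_cancel_left, abs_of_pos] <;> linarith
  have hm : |z₀ - r / 2 - z₀| < r := by
    rw [sub_sub_cancel_left, abs_neg, abs_of_pos] <;> linarith
  have lt1 : w (t₀, z₀ + r / 2) < w (t₀, z₀) := by
    have := (hw t₀ z₀ (z₀ + r / 2) m0 (hUV ⟨hmem₀, hVmem _ hp⟩) (by linarith)).1
    nlinarith
  have lt2 : w (t₀, z₀) < w (t₀, z₀ - r / 2) := by
    have := (hw t₀ (z₀ - r / 2) z₀ (hUV ⟨hmem₀, hVmem _ hm⟩) m0 (by linarith)).1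
    nlinarith
  rw [mem_interior_iff_mem_nhds]
  have hfst : Tendsto Prod.fst (𝓝 (t₀, w (t₀, z₀))) (𝓝 t₀) := continuous_fst.tendsto _
  have hsnd : Tendsto Prod.snd (𝓝 (t₀, w (t₀, z₀))) (𝓝 (w (t₀, z₀))) := continuous_snd.tendsto _
  have e1 := ((hcont _ hp).comp hfst).eventually_lt hsnd lt1
  have e2 := hsnd.eventually_lt ((hcont _ hm).comp hfst) lt2
  filter_upwards [e1, e2, hfst hU] with p h1 h2 h3
  have k1 := (h.2 p.1 (z₀ + r / 2) (hUV ⟨h3, hVmem _ hp⟩)).1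
  have k2 := (h.2 p.1 (z₀ - r / 2) (hUV ⟨h3, hVmem _ hm⟩)).1
  exact (hΩ.slice p.1).out k1 k2 ⟨h1.le, h2.le⟩

end Inverses

/-! ### Local inversion of test functions -/

section TestFunctions

variable {φ : ℝ × ℝ → ℝ} {p : ℝ × ℝ}

/-- A test function that is strictly decreasing in its second variable has a partial inverse near
`(p.1, φ p)`. -/
theorem exists_inverse_testFunction (hφ : ContDiffAt ℝ 1 φ p) (hneg : fderiv ℝ φ p (0, 1) < 0) :
    ∃ Φ : ℝ × ℝ → ℝ, ContDiffAt ℝ 1 Φ (p.1, φ p) ∧ Φ (p.1, φ p) = p.2 ∧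
      ∀ᶠ z in 𝓝 (p.1, φ p), φ (z.1, Φ z) = z.2 := by
  set c := fderiv ℝ φ p (1, 0) with hc
  set d := fderiv ℝ φ p (0, 1) with hd
  have hd0 : d ≠ 0 := hneg.ne
  have happ : ∀ x : ℝ × ℝ, fderiv ℝ φ p x = x.1 * c + x.2 * d := by
    intro x
    have : x = x.1 • ((1, 0) : ℝ × ℝ) + x.2 • ((0, 1) : ℝ × ℝ) := by ext <;> simp
    conv_lhs => rw [this]
    rw [map_add, map_smul, map_smul, smul_eq_mul, smul_eq_mul]
  -- The derivative of `G` is triangular with diagonal `1, d`, hence invertible; `K'` is its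
  -- explicit inverse.
  let G : ℝ × ℝ → ℝ × ℝ := fun q => (q.1, φ q)
  let G' : (ℝ × ℝ) →L[ℝ] ℝ × ℝ := (ContinuousLinearMap.fst ℝ ℝ ℝ).prod (fderiv ℝ φ p)
  let K' : (ℝ × ℝ) →L[ℝ] ℝ × ℝ := (ContinuousLinearMap.fst ℝ ℝ ℝ).prod
    (d⁻¹ • (ContinuousLinearMap.snd ℝ ℝ ℝ - c • ContinuousLinearMap.fst ℝ ℝ ℝ))
  let e : (ℝ × ℝ) ≃L[ℝ] ℝ × ℝ := ContinuousLinearEquiv.equivOfInverse G' K'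
    (fun x => by
      ext
      · simp [G', K']
      · simp [G', K', happ]; field_simp; ring)
    (fun x => by
      ext
      · simp [G', K']
      · simp [G', K', happ]; field_simp; ring)
  have hG : ContDiffAt ℝ 1 G p := contDiffAt_fst.prodMk hφ
  have hG' : HasFDerivAt G (e : (ℝ × ℝ) →L[ℝ] ℝ × ℝ) p :=
    hasFDerivAt_fst.prodMk (hφ.differentiableAt one_ne_zero).hasFDerivAt
  have hL := hG.to_localInverse hG' one_ne_zero
  have hs := hG.hasStrictFDerivAt' hG' one_ne_zero
  have hr := hs.eventually_right_inverse
  refine ⟨fun z => (hs.localInverse G e p z).2, contDiffAt_snd.comp _ hL, ?_, ?_⟩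
  · change (hs.localInverse G e p (G p)).2 = p.2
    rw [hs.localInverse_apply_image]
  · filter_upwards [hr] with z hz
    have h1 : (hs.localInverse G e p z).1 = z.1 := (Prod.ext_iff.1 hz).1
    have h2 : φ (hs.localInverse G e p z) = z.2 := (Prod.ext_iff.1 hz).2
    rw [← h2, ← h1]

theorem fderiv_inverse_testFunction (hφ : ContDiffAt ℝ 1 φ p) {Φ : ℝ × ℝ → ℝ}
    (hΦ : ContDiffAt ℝ 1 Φ (p.1, φ p)) (hp : Φ (p.1, φ p) = p.2)
    (hinv : ∀ᶠ z in 𝓝 (p.1, φ p), φ (z.1, Φ z) = z.2) :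
    fderiv ℝ φ p (1, 0) + fderiv ℝ Φ (p.1, φ p) (1, 0) * fderiv ℝ φ p (0, 1) = 0 ∧
      fderiv ℝ Φ (p.1, φ p) (0, 1) * fderiv ℝ φ p (0, 1) = 1 := by
  have h1 : HasFDerivAt φ (fderiv ℝ φ p) (p.1, Φ (p.1, φ p)) := by
    rw [hp]
    exact (hφ.differentiableAt one_ne_zero).hasFDerivAt
  have h2 : HasFDerivAt (fun z : ℝ × ℝ => (z.1, Φ z)) _ (p.1, φ p) :=
    hasFDerivAt_fst.prodMk (hΦ.differentiableAt one_ne_zero).hasFDerivAt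
  have h3 : HasFDerivAt (fun z : ℝ × ℝ => φ (z.1, Φ z)) (ContinuousLinearMap.snd ℝ ℝ ℝ)
      (p.1, φ p) := hasFDerivAt_snd.congr_of_eventuallyEq hinv
  have h4 := h3.unique (h1.comp (p.1, φ p) h2)
  have hsplit : ∀ r s : ℝ, fderiv ℝ φ p (r, s) =
      r * fderiv ℝ φ p (1, 0) + s * fderiv ℝ φ p (0, 1) := by
    intro r s
    have : ((r, s) : ℝ × ℝ) = r • ((1, 0) : ℝ × ℝ) + s • ((0, 1) : ℝ × ℝ) := by ext <;> simp
    rw [this, map_add, map_smul, map_smul, smul_eq_mul, smul_eq_mul]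
  have ht := DFunLike.congr_fun h4 (1, 0)
  have hy := DFunLike.congr_fun h4 (0, 1)
  simp only [ContinuousLinearMap.coe_snd', ContinuousLinearMap.comp_apply,
    ContinuousLinearMap.prod_apply, ContinuousLinearMap.coe_fst'] at ht hy
  rw [hsplit] at ht hy
  constructor <;> linarith

/-- Near a point at which `φ` has negative derivative in its second variable, `φ` is strictly
decreasing in that variable. -/
theorem eventually_lt_of_fderiv_neg (hφ : ContDiffAt ℝ 1 φ p) (hneg : fderiv ℝ φ p (0, 1) < 0) :
    ∀ᶠ q in 𝓝 (p, p), q.1.1 = q.2.1 → q.1.2 < q.2.2 → φ q.2 < φ q.1 := by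
  have hs := hφ.hasStrictFDerivAt one_ne_zero
  -- An error of half the slope cannot reverse the sign of the increment.
  have hb := hs.isLittleO.bound (c := -fderiv ℝ φ p (0, 1) / 2) (by linarith)
  filter_upwards [hb] with q hq h1 h2
  have hsub : q.1 - q.2 = (q.1.2 - q.2.2) • ((0, 1) : ℝ × ℝ) := by
    ext <;> simp [h1]
  have hnorm : ‖q.1 - q.2‖ = q.2.2 - q.1.2 := by
    rw [hsub, norm_smul, Prod.norm_def, Real.norm_eq_abs, abs_sub_comm, abs_of_pos (by linarith)]
    simp
  rw [hnorm, hsub, map_smul, smul_eq_mul, Real.norm_eq_abs] at hq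
  have := (abs_le.1 hq).1
  nlinarith

end TestFunctions

/-! ### Transfer of viscosity solutions -/

section Viscosity

variable {Ω Ω' : Set (ℝ × ℝ)} {u w : ℝ × ℝ → ℝ} {a b : ℝ} {F G : ℝ → ℝ}

/-- A function touching `u`, decreasing at rate at least `a`, from above or below, also decreases
at rate at least `a` at the point of contact. -/
theorem DecreasesAtRate.fderiv_le (hu : DecreasesAtRate a b Ω u) {φ : ℝ × ℝ → ℝ} {p : ℝ × ℝ}
    (hp : p ∈ interior Ω) (hφ : ContDiffAt ℝ 1 φ p) (h : IsLocalExtr (fun q => u q - φ q) p) :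
    fderiv ℝ φ p (0, 1) ≤ -a := by
  have hline : HasDerivAt (fun s : ℝ => (p.1, s)) ((0, 1) : ℝ × ℝ) p.2 :=
    (hasDerivAt_const p.2 p.1).prodMk (hasDerivAt_id p.2)
  have hd : HasDerivAt (fun s : ℝ => φ (p.1, s)) (fderiv ℝ φ p (0, 1)) p.2 :=
    HasFDerivAt.comp_hasDerivAt (f := fun s : ℝ => (p.1, s)) p.2
      (hφ.differentiableAt one_ne_zero).hasFDerivAt hline
  have hslope := hasDerivAt_iff_tendsto_slope.1 hd
  have hl : Tendsto (fun s : ℝ => (p.1, s)) (𝓝 p.2) (𝓝 p) := hline.continuousAt.tendsto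
  have hΩ : ∀ᶠ s in 𝓝 p.2, (p.1, s) ∈ Ω :=
    hl.eventually (mem_interior_iff_mem_nhds.1 hp)
  have hpΩ : (p.1, p.2) ∈ Ω := interior_subset hp
  -- At a minimum the right difference quotients of `φ` are at most those of `u`; at a maximum the
  -- left ones are.
  rcases h with h | h
  · have hright := hslope.mono_left
      (nhdsWithin_mono p.2 (fun s hs => ne_of_gt hs : Ioi p.2 ⊆ {p.2}ᶜ))
    refine le_of_tendsto hright ?_
    filter_upwards [self_mem_nhdsWithin, nhdsWithin_le_nhds hΩ,
      nhdsWithin_le_nhds (hl.eventually h)] with s hs hsΩ hmin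
    have hs' : p.2 < s := hs
    have := (hu p.1 p.2 s hpΩ hsΩ hs'.le).1
    rw [slope_def_field, div_le_iff₀ (by linarith)]
    change u p - φ p ≤ _ at hmin
    change φ (p.1, s) - φ p ≤ _
    change _ ≤ u p - _ at this
    linarith
  · have hleft := hslope.mono_left
      (nhdsWithin_mono p.2 (fun s hs => ne_of_lt hs : Iio p.2 ⊆ {p.2}ᶜ))
    refine le_of_tendsto hleft ?_
    filter_upwards [self_mem_nhdsWithin, nhdsWithin_le_nhds hΩ,
      nhdsWithin_le_nhds (hl.eventually h)] with s hs hsΩ hmax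
    have hs' : s < p.2 := hs
    have := (hu p.1 s p.2 hsΩ hpΩ hs'.le).1
    rw [slope_def_field, div_le_iff_of_neg (by linarith)]
    change _ ≤ u p - φ p at hmax
    change _ ≤ φ (p.1, s) - φ p
    change _ ≤ _ - u p at this
    linarith

/-- Test functions touching the inverse `w` of `u` correspond to test functions touching `u`, on
the same side. -/
theorem ArePartialInverses.exists_testFunction (h : ArePartialInverses Ω Ω' u w)
    (hw : DecreasesAtRate a b Ω' w) (ha : 0 < a) (hc : ContinuousOn u Ω) {φ : ℝ × ℝ → ℝ}
    {q : ℝ × ℝ} (hq : q ∈ interior Ω') (hq' : (q.1, w q) ∈ interior Ω)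
    (hφ : ContDiffAt ℝ 1 φ q) (hext : IsLocalExtr (fun z => w z - φ z) q) :
    ∃ Φ : ℝ × ℝ → ℝ, ContDiffAt ℝ 1 Φ (q.1, w q) ∧
      (IsLocalMax (fun z => w z - φ z) q → IsLocalMax (fun z => u z - Φ z) (q.1, w q)) ∧
      (IsLocalMin (fun z => w z - φ z) q → IsLocalMin (fun z => u z - Φ z) (q.1, w q)) ∧
      fderiv ℝ φ q (0, 1) < 0 ∧
      fderiv ℝ φ q (1, 0) + fderiv ℝ Φ (q.1, w q) (1, 0) * fderiv ℝ φ q (0, 1) = 0 ∧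
      fderiv ℝ Φ (q.1, w q) (0, 1) * fderiv ℝ φ q (0, 1) = 1 := by
  have hneg : fderiv ℝ φ q (0, 1) < 0 := by linarith [hw.fderiv_le hq hφ hext]
  -- shift the test function so that it touches `w`
  obtain ⟨χ, hχ, hχq, hχφ, hχd⟩ : ∃ χ : ℝ × ℝ → ℝ, ContDiffAt ℝ 1 χ q ∧ χ q = w q ∧
      (∀ z, χ z - w q = φ z - φ q) ∧ fderiv ℝ χ q = fderiv ℝ φ q :=
    ⟨fun z => φ z + (w q - φ q), hφ.add contDiffAt_const, by ring, fun z => by ring,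
      fderiv_add_const _⟩
  rw [← hχd] at hneg ⊢
  obtain ⟨Φ, hΦ, hΦq, hinv⟩ := exists_inverse_testFunction hχ hneg
  have hder := fderiv_inverse_testFunction hχ hΦ hΦq hinv
  rw [hχq] at hΦ hΦq hinv hder
  have huq : u (q.1, w q) = q.2 := (h.2 q.1 q.2 (interior_subset hq)).2
  have hΩ := mem_interior_iff_mem_nhds.1 hq'
  have hu' : Tendsto (fun z : ℝ × ℝ => (z.1, u z)) (𝓝 (q.1, w q)) (𝓝 q) := by
    have : ContinuousAt (fun z : ℝ × ℝ => (z.1, u z)) (q.1, w q) :=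
      continuousAt_fst.prodMk (hc.continuousAt hΩ)
    simpa [ContinuousAt, huq] using this
  have hΦ' : Tendsto (fun z : ℝ × ℝ => (z.1, Φ z)) (𝓝 (q.1, w q)) (𝓝 q) := by
    have : ContinuousAt (fun z : ℝ × ℝ => (z.1, Φ z)) (q.1, w q) :=
      continuousAt_fst.prodMk hΦ.continuousAt
    simpa [ContinuousAt, hΦq] using this
  have hlt := eventually_lt_of_fderiv_neg hχ hneg
  refine ⟨Φ, hΦ, fun hmax => ?_, fun hmin => ?_, hneg, hder⟩
  · filter_upwards [hΩ, hinv, hu'.eventually hmax,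
      (hΦ'.prodMk_nhds hu').eventually hlt] with z hz hzinv hzmax hzlt
    rw [huq, hΦq, sub_self, sub_nonpos]
    -- If `Φ z < u z`, then `χ(z.1, u z) < χ(z.1, Φ z) = z.2 = w(z.1, u z)`, so `w - χ` is positive
    -- near `q`, against the maximum.
    by_contra hcon
    push Not at hcon
    have h1 := hzlt rfl hcon
    have h2 := (h.1 z.1 z.2 hz).2
    simp only [Prod.mk.eta] at h2 hzmax h1
    have h3 := hχφ (z.1, u z)
    linarith
  · filter_upwards [hΩ, hinv, hu'.eventually hmin,
      (hu'.prodMk_nhds hΦ').eventually hlt] with z hz hzinv hzmin hzlt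
    rw [huq, hΦq, sub_self, sub_nonneg]
    by_contra hcon
    push Not at hcon
    have h1 := hzlt rfl hcon
    have h2 := (h.1 z.1 z.2 hz).2
    simp only [Prod.mk.eta] at h2 hzmin h1
    have h3 := hχφ (z.1, u z)
    linarith

/-- The partial inverse of a viscosity solution of `u_t - F(-u_y) = 0` is a viscosity solution of
`w_t - G(-w_z) = 0`, where `G s = F(1/s) s`. -/
theorem IsViscositySolution.inverse (hu : IsViscositySolution (fun p => -F (-p)) Ω u)
    (hΩ : IsDomain Ω) (hr : DecreasesAtRate a b Ω u) (ha : 0 < a) (hb : 0 < b)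
    (h : ArePartialInverses Ω Ω' u w) (hFG : ∀ s > 0, G s = F (1 / s) * s) :
    IsViscositySolution (fun p => -G (-p)) Ω' w := by
  have hc : ContinuousOn u Ω := hu.1.1
  have hw := hr.inverse ha hb h
  have hwc := h.continuousOn hΩ hr hc ha hb
  have hb' : 0 < 1 / b := one_div_pos.2 hb
  -- The residuals differ by the positive factor `-B`; `A, B` are the derivatives of `φ`, and `A',
  -- B'` those of its inverse.
  have hpos : ∀ {A B A' B' : ℝ}, B < 0 → A + A' * B = 0 → B' * B = 1 →
      A + -G (-B) = (A' + -F (-B')) * -B := by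
    intro A B A' B' hB h1 h2
    have hB' : 1 / (-B) = -B' := by
      rw [div_eq_iff (by linarith)]
      linarith
    rw [hFG _ (by linarith), hB']
    linarith
  refine ⟨⟨hwc, fun φ q hq hφ hmax => ?_⟩, ⟨hwc, fun φ q hq hφ hmin => ?_⟩⟩
  · have hq' := h.mem_interior hΩ hw hwc hb' hq
    obtain ⟨Φ, hΦ, himp, -, hneg, h1, h2⟩ :=
      h.exists_testFunction hw hb' hc hq hq' hφ (Or.inr hmax)
    have := hu.1.2 Φ _ hq' hΦ (himp hmax)
    rw [hpos hneg h1 h2]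
    exact mul_nonpos_of_nonpos_of_nonneg this (by linarith)
  · have hq' := h.mem_interior hΩ hw hwc hb' hq
    obtain ⟨Φ, hΦ, -, himp, hneg, h1, h2⟩ :=
      h.exists_testFunction hw hb' hc hq hq' hφ (Or.inl hmin)
    have := hu.2.2 Φ _ hq' hΦ (himp hmin)
    rw [hpos hneg h1 h2]
    exact mul_nonneg this (by linarith)

end Viscosity

/-! ### Eulerian and Lagrangian solutions -/

section Equivalence

variable {f : ℝ → ℝ} {δ ρmax : ℝ} {ΩE ΩL : Set (ℝ × ℝ)} {τmin τmax : ℝ} {t x n : ℝ → ℝ}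
  {CE CL N X : ℝ × ℝ → ℝ}

theorem IsEulerianSolution.inverse
    (hN : IsEulerianSolution f δ ρmax ΩE τmin τmax t x CE N) (hδ : 0 < δ) (hρ : 0 < ρmax)
    (hΩE : IsDomain ΩE) (hmem : ∀ τ ∈ Icc τmin τmax, (t τ, x τ) ∈ ΩE)
    (hn : ∀ τ ∈ Icc τmin τmax, n τ = CE (t τ, x τ))
    (hx : ∀ τ ∈ Icc τmin τmax, x τ = CL (t τ, n τ))
    (h : ArePartialInverses ΩE ΩL N X) :
    IsLagrangianSolution f δ ρmax ΩL τmin τmax t n CL X where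
  viscosity := hN.viscosity.inverse hΩE hN.density hδ hρ h fun _ _ => rfl
  spacing := hN.density.inverse hδ hρ h
  value τ hτ := by
    rw [← hx τ hτ, hn τ hτ, ← hN.value τ hτ]
    exact (h.1 _ _ (hmem τ hτ)).2

theorem IsLagrangianSolution.inverse
    (hX : IsLagrangianSolution f δ ρmax ΩL τmin τmax t n CL X) (hδ : 0 < δ) (hρ : 0 < ρmax)
    (hΩL : IsDomain ΩL) (hmem : ∀ τ ∈ Icc τmin τmax, (t τ, n τ) ∈ ΩL)
    (hn : ∀ τ ∈ Icc τmin τmax, n τ = CE (t τ, x τ))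
    (hx : ∀ τ ∈ Icc τmin τmax, x τ = CL (t τ, n τ))
    (h : ArePartialInverses ΩE ΩL N X) :
    IsEulerianSolution f δ ρmax ΩE τmin τmax t x CE N where
  -- The transform is an involution: `ψ(1/s) s = f s` for `s > 0`.
  viscosity := hX.viscosity.inverse hΩL hX.spacing (one_div_pos.2 hρ) (one_div_pos.2 hδ) h.symm
    fun s hs => by
      rw [spacingVelocity, one_div_one_div, mul_assoc, one_div_mul_cancel hs.ne', mul_one]
  density := by
    simpa only [one_div_one_div] using
      hX.spacing.inverse (one_div_pos.2 hρ) (one_div_pos.2 hδ) h.symm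
  value τ hτ := by
    rw [← hn τ hτ, hx τ hτ, ← hX.value τ hτ]
    exact (h.2 _ _ (hmem τ hτ)).2

end Equivalence

end LWR

theorem proposition3
    (f v : ℝ → ℝ) (δ ρmax vmax : ℝ)
    (hf : LWR.IsFundamentalDiagram f v ρmax vmax) (hδ : 0 < δ)
    (ΩE ΩL : Set (ℝ × ℝ)) (hΩE : LWR.IsDomain ΩE) (hΩL : LWR.IsDomain ΩL)
    (τmin τmax : ℝ) (t x n : ℝ → ℝ) (CE CL : ℝ × ℝ → ℝ)
    (hCE : LWR.IsValueCondition ΩE τmin τmax t x CE)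
    (hCL : LWR.IsValueCondition ΩL τmin τmax t n CL)
    (hn : ∀ τ ∈ Set.Icc τmin τmax, n τ = CE (t τ, x τ))
    (hx : ∀ τ ∈ Set.Icc τmin τmax, x τ = CL (t τ, n τ)) :
    -- the partial inverse of an Eulerian solution exists and is a Lagrangian solution
    (∀ N : ℝ × ℝ → ℝ, LWR.IsEulerianSolution f δ ρmax ΩE τmin τmax t x CE N →
      LWR.dualDomain ΩE N = ΩL →
      ∃ X : ℝ × ℝ → ℝ, LWR.ArePartialInverses ΩE ΩL N X ∧
        LWR.IsLagrangianSolution f δ ρmax ΩL τmin τmax t n CL X) ∧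
    -- the partial inverse of a Lagrangian solution exists and is an Eulerian solution
    (∀ X : ℝ × ℝ → ℝ, LWR.IsLagrangianSolution f δ ρmax ΩL τmin τmax t n CL X →
      LWR.dualDomain ΩL X = ΩE →
      ∃ N : ℝ × ℝ → ℝ, LWR.ArePartialInverses ΩE ΩL N X ∧
        LWR.IsEulerianSolution f δ ρmax ΩE τmin τmax t x CE N) ∧
    -- the partial inverse of an Eulerian solution is the Lagrangian solution, if that is unique
    (∀ N X : ℝ × ℝ → ℝ, LWR.IsEulerianSolution f δ ρmax ΩE τmin τmax t x CE N →
      LWR.dualDomain ΩE N = ΩL →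
      LWR.IsLagrangianSolution f δ ρmax ΩL τmin τmax t n CL X →
      (∀ X' : ℝ × ℝ → ℝ, LWR.IsLagrangianSolution f δ ρmax ΩL τmin τmax t n CL X' →
        LWR.dualDomain ΩL X' = ΩE → Set.EqOn X' X ΩL) →
      LWR.ArePartialInverses ΩE ΩL N X) ∧
    -- the partial inverse of a Lagrangian solution is the Eulerian solution, if that is unique
    (∀ N X : ℝ × ℝ → ℝ, LWR.IsLagrangianSolution f δ ρmax ΩL τmin τmax t n CL X →
      LWR.dualDomain ΩL X = ΩE →
      LWR.IsEulerianSolution f δ ρmax ΩE τmin τmax t x CE N →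
      (∀ N' : ℝ × ℝ → ℝ, LWR.IsEulerianSolution f δ ρmax ΩE τmin τmax t x CE N' →
        LWR.dualDomain ΩE N' = ΩL → Set.EqOn N' N ΩE) →
      LWR.ArePartialInverses ΩE ΩL N X) ∧
    -- one of the two problems has exactly one solution if and only if the other one has
    ((∃ N : ℝ × ℝ → ℝ, (LWR.IsEulerianSolution f δ ρmax ΩE τmin τmax t x CE N ∧
        LWR.dualDomain ΩE N = ΩL) ∧
        ∀ N' : ℝ × ℝ → ℝ, LWR.IsEulerianSolution f δ ρmax ΩE τmin τmax t x CE N' →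
          LWR.dualDomain ΩE N' = ΩL → Set.EqOn N' N ΩE) ↔
      (∃ X : ℝ × ℝ → ℝ, (LWR.IsLagrangianSolution f δ ρmax ΩL τmin τmax t n CL X ∧
        LWR.dualDomain ΩL X = ΩE) ∧
        ∀ X' : ℝ × ℝ → ℝ, LWR.IsLagrangianSolution f δ ρmax ΩL τmin τmax t n CL X' →
          LWR.dualDomain ΩL X' = ΩE → Set.EqOn X' X ΩL)) := by
  have hρ := hf.ρmax_pos
  have hE : ∀ N, LWR.IsEulerianSolution f δ ρmax ΩE τmin τmax t x CE N →
      LWR.dualDomain ΩE N = ΩL →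
      ∃ X : ℝ × ℝ → ℝ, LWR.ArePartialInverses ΩE ΩL N X ∧
        LWR.IsLagrangianSolution f δ ρmax ΩL τmin τmax t n CL X := by
    intro N hN hD
    obtain ⟨X, hNX⟩ := hN.density.exists_arePartialInverses hδ hD
    exact ⟨X, hNX, hN.inverse hδ hρ hΩE hCE.mem hn hx hNX⟩
  have hL : ∀ X, LWR.IsLagrangianSolution f δ ρmax ΩL τmin τmax t n CL X →
      LWR.dualDomain ΩL X = ΩE →
      ∃ N : ℝ × ℝ → ℝ, LWR.ArePartialInverses ΩE ΩL N X ∧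
        LWR.IsEulerianSolution f δ ρmax ΩE τmin τmax t x CE N := by
    intro X hX hD
    obtain ⟨N, hXN⟩ := hX.spacing.exists_arePartialInverses (one_div_pos.2 hρ) hD
    exact ⟨N, hXN.symm, hX.inverse hδ hρ hΩL hCL.mem hn hx hXN.symm⟩
  refine ⟨hE, hL, ?_, ?_, ?_, ?_⟩
  · intro N X hN hD _ huniq
    obtain ⟨X', hNX, hX'⟩ := hE N hN hD
    exact hNX.congr_right (huniq X' hX' hNX.symm.dualDomain_eq)
  · intro N X hX hD _ huniq
    obtain ⟨N', hNX, hN'⟩ := hL X hX hD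
    exact (hNX.symm.congr_right (huniq N' hN' hNX.dualDomain_eq)).symm
  · rintro ⟨N, ⟨hN, hD⟩, huniq⟩
    obtain ⟨X, hNX, hX⟩ := hE N hN hD
    -- The inverse `N'` of a competitor `X'` agrees with `N`, so `X'` and `X` both invert `N`.
    refine ⟨X, ⟨hX, hNX.symm.dualDomain_eq⟩, fun X' hX' hD' => ?_⟩
    obtain ⟨N', hNX', hN'⟩ := hL X' hX' hD'
    exact (hNX'.symm.congr_right (huniq N' hN' hNX'.dualDomain_eq)).symm.eqOn hNX
  · rintro ⟨X, ⟨hX, hD⟩, huniq⟩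
    obtain ⟨N, hNX, hN⟩ := hL X hX hD
    refine ⟨N, ⟨hN, hNX.dualDomain_eq⟩, fun N' hN' hD' => ?_⟩
    obtain ⟨X', hNX', hX'⟩ := hE N' hN' hD'
    exact (hNX'.congr_right (huniq X' hX' hNX'.symm.dualDomain_eq)).symm.eqOn hNX.symm
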